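/- Let $k,N\ge 1$ be integers and let $v_1,\dots,v_N$ be non-zero vectors in $\mathbb R^2$ such that $\{v_i,v_j\}$ is a basis of $\mathbb R^2$ whenever $i\neq j$. For $v=(v^1,v^2)\in\mathbb R^2$ and $x=(x^1,x^2)\in\mathbb R^k\times\mathbb R^k=\mathbb R^{2k}$ put $v\cdot x=v^1x^1+v^2x^2\in\mathbb R^k$, and for non-negative measurable functions $f_1,\dots,f_N$ on $\mathbb R^k$ (the value $+\infty$ is allowed) put $$\Lambda(f_1,\dots,f_N)=\int_{\mathbb R^{2k}} f_1(v_1\cdot x)\cdots f_N(v_N\cdot x)\,dx .$$ For $1\le p,r\le\infty$ and a non-negative measurable function $f$ on $\mathbb R^k$ with decreasing rearrangement $f^*(t)=\inf\{s\ge 0: |\{f>s\}|\le t\}$, the Lorentz quasi-norm is $$\|f\|_{L^{p,r}}=\Big(\int_0^\infty \big(t^{1/p}f^*(t)\big)^r\,\frac{dt}{t}\Big)^{1/r}\quad (r<\infty),\qquad \|f\|_{L^{p,\infty}}=\sup_{t>0}t^{1/p}f^*(t).$$ **Theorem.** Suppose that $(1/p_1,\dots,1/p_N)\in(0,1)^N$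 satisfies $\sum_{j=1}^N \frac1{p_j}=2$, and that $1\le r_1,\dots,r_N\le\infty$ satisfy $\sum_{j=1}^N\frac1{r_j}\ge 1$. Then there is a finite constant $C$, depending only on $k$, $N$, the vectors $v_j$ and the exponents $p_j,r_j$, such that $$\Lambda(f_1,\dots,f_N)\le C\prod_{j=1}^N\|f_j\|_{L^{p_j,r_j}}$$ for all non-negative measurable functions $f_1,\dots,f_N$ on $\mathbb R^k$, with the convention $0\cdot\infty=0$. In particular, the conditions on the exponents do not depend on the dimension $k$. -/

import Mathlib

open MeasureTheory Set
open scoped ENNReal NNReal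

noncomputable section

/-- The decreasing rearrangement `f*(t) = inf {s ≥ 0 : μ {x | f x > s} ≤ t}` of a non-negative
(extended-valued) function. -/
def decreasingRearrangement {α : Type*} [MeasurableSpace α] (μ : Measure α) (f : α → ℝ≥0∞)
    (t : ℝ≥0∞) : ℝ≥0∞ :=
  sInf {s : ℝ≥0∞ | μ {x | s < f x} ≤ t}

/-- The Lorentz quasi-norm of a non-negative function:
`(∫₀^∞ (t^{1/p} f*(t))^r dt/t)^{1/r}` if `r < ∞`, and `sup_{t > 0} t^{1/p} f*(t)` if `r = ∞`. -/
def lorentzNorm {α : Type*} [MeasurableSpace α] (μ : Measure α) (p r : ℝ≥0∞)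
    (f : α → ℝ≥0∞) : ℝ≥0∞ :=
  if r = ∞ then
    ⨆ t ∈ Ioi (0 : ℝ),
      ENNReal.ofReal t ^ (p⁻¹).toReal * decreasingRearrangement μ f (ENNReal.ofReal t)
  else
    (∫⁻ t in Ioi (0 : ℝ),
      (ENNReal.ofReal t ^ (p⁻¹).toReal *
        decreasingRearrangement μ f (ENNReal.ofReal t)) ^ r.toReal / ENNReal.ofReal t)
      ^ (1 / r.toReal)

/-- For `v = (v¹, v²) ∈ ℝ²` and `x = (x¹, x²) ∈ ℝᵏ × ℝᵏ = ℝ²ᵏ`, the vector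
`v · x = v¹ x¹ + v² x² ∈ ℝᵏ`. -/
def vecDot {k : ℕ} (v : Fin 2 → ℝ) (x : (Fin k → ℝ) × (Fin k → ℝ)) : Fin k → ℝ :=
  v 0 • x.1 + v 1 • x.2

/-- The form `Λ(f₁, …, f_N) = ∫_{ℝ²ᵏ} f₁(v₁ · x) ⋯ f_N(v_N · x) dx` on non-negative functions on
`ℝᵏ`, with respect to Lebesgue measure on `ℝ²ᵏ = ℝᵏ × ℝᵏ`. -/
def brascampLiebForm {N k : ℕ} (v : Fin N → Fin 2 → ℝ) (f : Fin N → (Fin k → ℝ) → ℝ≥0∞) :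
    ℝ≥0∞ :=
  ∫⁻ x : (Fin k → ℝ) × (Fin k → ℝ), ∏ j, f j (vecDot (v j) x)

end

/-! ### Level sets and dyadic majorants -/

section Rearrangement

variable {α : Type*} [MeasurableSpace α] {μ : Measure α} {f : α → ℝ≥0∞}

/-! Dominate each f_j by ∑_m f_j*(2^m) 1_{E_{j,m}} with |E_{j,m}| ≤ 2^(m+1)
(`exists_dyadic_majorant`) and expand Λ over multi-indices m. For indicators, dropping all factors
but two and changing variables gives Λ ≲ |E_i||E_j| for every pair i ≠ j
(`exists_lintegral_indicator_vecDot_le`).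

Since (1/p_j) is interior to the hypersimplex {∑ = 2}, the best pair gains 2^(-δ|m_l - m_{j₀}|) in
every l (`exists_pair_add_le_sum`). The sum is thus concentrated near the diagonal. For fixed
differences, Hölder on ℤ with weights θ_j ≤ 1/r_j of sum 1 bounds the diagonal sum, and the
differences sum geometrically (`tsum_prod_kernel_le`). -/

theorem decreasingRearrangement_antitone (μ : Measure α) (f : α → ℝ≥0∞) :
    Antitone (decreasingRearrangement μ f) :=
  fun _ _ h => sInf_le_sInf fun _ hu => le_trans hu h

theorem measure_decreasingRearrangement_lt_le (μ : Measure α) (f : α → ℝ≥0∞) (t : ℝ≥0∞) :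
    μ {x | decreasingRearrangement μ f t < f x} ≤ t := by
  obtain ⟨u, hu, hlim, hmem⟩ := exists_seq_tendsto_sInf
    (S := {s : ℝ≥0∞ | μ {x | s < f x} ≤ t}) ⟨∞, by simp⟩ (OrderBot.bddBelow _)
  have hset : {x | decreasingRearrangement μ f t < f x} = ⋃ n, {x | u n < f x} := by
    ext x
    simp only [mem_ofPred_eq, mem_iUnion]
    constructor
    · intro hx
      exact (hlim.eventually (gt_mem_nhds hx)).exists
    · rintro ⟨n, hn⟩
      exact (sInf_le (hmem n)).trans_lt hn
  have hmono : Monotone fun n => {x | u n < f x} :=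
    fun _ _ hmn _ hx => (hu hmn).trans_lt hx
  rw [hset, hmono.measure_iUnion]
  exact iSup_le hmem

theorem ENNReal.two_rpow_ne_top (x : ℝ) : (2 : ℝ≥0∞) ^ x ≠ ∞ := by
  simp [ENNReal.rpow_eq_top_iff]

theorem ENNReal.two_rpow_pos (x : ℝ) : 0 < (2 : ℝ≥0∞) ^ x :=
  ENNReal.rpow_pos two_pos ENNReal.ofNat_ne_top

theorem ENNReal.exists_two_rpow_int_lt {c : ℝ≥0∞} (hc : c ≠ 0) :
    ∃ m : ℤ, (2 : ℝ≥0∞) ^ (m : ℝ) < c := by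
  obtain ⟨n, hn⟩ := ENNReal.exists_inv_two_pow_lt hc
  refine ⟨-n, ?_⟩
  rw [Int.cast_neg, ENNReal.rpow_neg]
  simpa [ENNReal.inv_pow] using hn

/-- A function is dominated almost everywhere by the sum over `m` of the value of its rearrangement
at `2 ^ m` times the indicator of a set of measure at most `2 ^ (m + 1)`. -/
theorem exists_dyadic_majorant
    (hf : ∀ c, c ≠ 0 → ∃ m : ℤ, decreasingRearrangement μ f (2 ^ (m : ℝ)) < c) :
    ∃ E : ℤ → Set α, (∀ m, MeasurableSet (E m)) ∧
      (∀ m : ℤ, μ (E m) ≤ 2 ^ ((m : ℝ) + 1)) ∧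
      ∀ᵐ x ∂μ, f x ≤
        ∑' m : ℤ, decreasingRearrangement μ f (2 ^ (m : ℝ)) * (E m).indicator 1 x := by
  set b : ℤ → ℝ≥0∞ := fun m => decreasingRearrangement μ f (2 ^ (m : ℝ))
  have hanti : Antitone b := fun m n hmn => decreasingRearrangement_antitone μ f
    (ENNReal.rpow_le_rpow_of_exponent_le one_le_two (by exact_mod_cast hmn))
  -- The exceptional set lies in every {f > b m}, of measure at most 2^m; let m → -∞.
  have hnull : ∀ᵐ x ∂μ, ∃ m, f x ≤ b m := by
    rw [ae_iff]
    by_contra hne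
    obtain ⟨m, hm⟩ := ENNReal.exists_two_rpow_int_lt hne
    refine hm.not_ge (le_trans (measure_mono fun x hx => ?_)
      (measure_decreasingRearrangement_lt_le μ f (2 ^ (m : ℝ))))
    simp only [not_exists, not_le, mem_ofPred_eq] at hx
    exact hx m
  refine ⟨fun m => toMeasurable μ {x | b (m + 1) < f x}, fun m => measurableSet_toMeasurable _ _,
    fun m => ?_, ?_⟩
  · rw [measure_toMeasurable, show (m : ℝ) + 1 = ((m + 1 : ℤ) : ℝ) by push_cast; rfl]
    exact measure_decreasingRearrangement_lt_le μ f (2 ^ ((m + 1 : ℤ) : ℝ))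
  · filter_upwards [hnull] with x ⟨m₀, hm₀⟩
    rcases eq_or_ne (f x) 0 with h0 | h0
    · simp [h0]
    obtain ⟨m₁, hm₁⟩ := hf _ h0
    -- The last m with f x ≤ b m exists because `hf` pushes b below f x; then b (m + 1) < f x puts x
    -- in the m-th set.
    obtain ⟨m, hm, hmax⟩ := Int.exists_greatest_of_bdd (P := fun m => f x ≤ b m)
      ⟨m₁, fun z hz => by
        by_contra! hlt
        exact (hz.trans (hanti hlt.le)).not_gt hm₁⟩ ⟨m₀, hm₀⟩
    have hlt : b (m + 1) < f x := by
      by_contra! hle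
      have := hmax _ hle
      omega
    have hmem : x ∈ toMeasurable μ {x | b (m + 1) < f x} := subset_toMeasurable _ _ hlt
    refine le_trans ?_ (ENNReal.le_tsum m)
    rw [indicator_of_mem hmem, Pi.one_apply, mul_one]
    exact hm

end Rearrangement

/-! ### Lorentz norms as weighted sequence norms -/

section Lorentz

variable {α : Type*} [MeasurableSpace α] {μ : Measure α} {p r : ℝ≥0∞} {f : α → ℝ≥0∞}

/-- The weighted value `(2 ^ m) ^ (1 / p) * f* (2 ^ m)` of the rearrangement. -/
noncomputable def dyadicCoeff (μ : Measure α) (p : ℝ≥0∞) (f : α → ℝ≥0∞) (m : ℤ) : ℝ≥0∞ :=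
  (2 ^ (m : ℝ)) ^ (p⁻¹).toReal * decreasingRearrangement μ f (2 ^ (m : ℝ))

theorem ENNReal.ofReal_two_zpow (m : ℤ) :
    ENNReal.ofReal ((2 : ℝ) ^ m) = (2 : ℝ≥0∞) ^ (m : ℝ) := by
  rw [← Real.rpow_intCast, ← ENNReal.ofReal_rpow_of_pos two_pos, ENNReal.ofReal_ofNat]

theorem dyadicCoeff_div_two_le (hp : p⁻¹ ≤ 1) {m : ℤ} {t : ℝ}
    (ht : t ∈ Ioc ((2 : ℝ) ^ m) (2 ^ (m + 1))) :
    dyadicCoeff μ p f (m + 1) / 2 ≤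
      ENNReal.ofReal t ^ (p⁻¹).toReal * decreasingRearrangement μ f (ENNReal.ofReal t) := by
  have hp1 : (p⁻¹).toReal ≤ 1 := by simpa using ENNReal.toReal_mono ENNReal.one_ne_top hp
  have htop : ENNReal.ofReal t ≤ 2 ^ ((m + 1 : ℤ) : ℝ) := by
    rw [← ENNReal.ofReal_two_zpow]
    exact ENNReal.ofReal_le_ofReal ht.2
  have hbot : (2 : ℝ≥0∞) ^ ((m + 1 : ℤ) : ℝ) ≤ 2 * ENNReal.ofReal t := by
    rw [← ENNReal.ofReal_two_zpow, zpow_add₀ two_ne_zero, mul_comm, zpow_one,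
      ENNReal.ofReal_mul zero_le_two, ENNReal.ofReal_ofNat]
    gcongr
    exact ht.1.le
  have hpow : ((2 : ℝ≥0∞) ^ ((m + 1 : ℤ) : ℝ)) ^ (p⁻¹).toReal ≤
      2 * ENNReal.ofReal t ^ (p⁻¹).toReal := by
    calc _ ≤ (2 * ENNReal.ofReal t) ^ (p⁻¹).toReal :=
          ENNReal.rpow_le_rpow hbot ENNReal.toReal_nonneg
      _ = 2 ^ (p⁻¹).toReal * ENNReal.ofReal t ^ (p⁻¹).toReal :=
          ENNReal.mul_rpow_of_nonneg _ _ ENNReal.toReal_nonneg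
      _ ≤ _ := by
          gcongr
          simpa using ENNReal.rpow_le_rpow_of_exponent_le (x := 2) one_le_two hp1
  refine ENNReal.div_le_of_le_mul ?_
  calc dyadicCoeff μ p f (m + 1)
      ≤ 2 * ENNReal.ofReal t ^ (p⁻¹).toReal *
        decreasingRearrangement μ f (ENNReal.ofReal t) := by
        unfold dyadicCoeff
        gcongr
        exact decreasingRearrangement_antitone μ f htop
    _ = _ := by ring

/-- Compare on the shells (2^m, 2^(m+1)]. One factor 2 of the 4 comes from `dyadicCoeff_div_two_le`,
the other from the dt/t-mass of a shell being at least 1/2, absorbed using r ≥ 1. -/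
theorem tsum_dyadicCoeff_rpow_le (hp : p⁻¹ ≤ 1) (hr : 1 ≤ r) (hrtop : r ≠ ∞) :
    ∑' m : ℤ, (dyadicCoeff μ p f m / 4) ^ r.toReal ≤ lorentzNorm μ p r f ^ r.toReal := by
  have hr1 : 1 ≤ r.toReal := by simpa using ENNReal.toReal_mono hrtop hr
  have hr0 : r.toReal ≠ 0 := by positivity
  rw [lorentzNorm, if_neg hrtop, ← ENNReal.rpow_mul, one_div_mul_cancel hr0, ENNReal.rpow_one,
    ← (Equiv.addRight (1 : ℤ)).tsum_eq]
  have hdisj : Pairwise (Function.onFun Disjoint fun m : ℤ => Ioc ((2 : ℝ) ^ m) (2 ^ (m + 1))) :=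
    (zpow_right_mono₀ (one_le_two (α := ℝ))).pairwise_disjoint_on_Ioc_succ
  refine le_trans ?_ (lintegral_mono_set (s := ⋃ m : ℤ, Ioc ((2 : ℝ) ^ m) (2 ^ (m + 1))) ?_)
  swap
  · exact iUnion_subset fun m t ht => lt_trans (by positivity) ht.1
  rw [lintegral_iUnion (fun m => measurableSet_Ioc) hdisj]
  refine ENNReal.tsum_le_tsum fun m => ?_
  set c := dyadicCoeff μ p f (m + 1)
  have h2 : (2 : ℝ) ^ (m + 1) - 2 ^ m = 2 ^ m := by
    rw [zpow_add₀ two_ne_zero]; ring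
  have hm0 : ENNReal.ofReal ((2 : ℝ) ^ m) ≠ 0 := by
    simpa using (by positivity : (0 : ℝ) < 2 ^ m)
  calc (c / 4) ^ r.toReal = (c / 2 * 2⁻¹) ^ r.toReal := by
        congr 1
        rw [div_eq_mul_inv, div_eq_mul_inv, mul_assoc, ← ENNReal.mul_inv (by simp) (by simp)]
        norm_num
    _ ≤ (c / 2) ^ r.toReal * 2⁻¹ := by
        rw [ENNReal.mul_rpow_of_nonneg _ _ (by positivity)]
        gcongr
        simpa using ENNReal.rpow_le_rpow_of_exponent_ge (x := 2⁻¹) (by simp) hr1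
    _ = (c / 2) ^ r.toReal / ENNReal.ofReal (2 ^ (m + 1)) *
          volume (Ioc ((2 : ℝ) ^ m) (2 ^ (m + 1))) := by
        rw [Real.volume_Ioc, h2, zpow_add₀ two_ne_zero, zpow_one,
          ENNReal.ofReal_mul (by positivity), ENNReal.ofReal_ofNat,
          div_eq_mul_inv _ (ENNReal.ofReal (2 ^ m) * 2), mul_assoc,
          ENNReal.mul_inv (Or.inl hm0) (Or.inl ENNReal.ofReal_ne_top), mul_right_comm (ENNReal.ofReal _)⁻¹,
          ENNReal.inv_mul_cancel hm0 ENNReal.ofReal_ne_top, one_mul]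
    _ = ∫⁻ _ in Ioc ((2 : ℝ) ^ m) (2 ^ (m + 1)),
          (c / 2) ^ r.toReal / ENNReal.ofReal (2 ^ (m + 1)) := by
        rw [setLIntegral_const]
    _ ≤ _ := by
        refine setLIntegral_mono' measurableSet_Ioc fun t ht => ?_
        gcongr
        · exact dyadicCoeff_div_two_le hp ht
        · exact ht.2

theorem dyadicCoeff_le_lorentzNorm (hp : p⁻¹ ≤ 1) (hr : 1 ≤ r) (m : ℤ) :
    dyadicCoeff μ p f m ≤ 4 * lorentzNorm μ p r f := by
  rcases eq_or_ne r ∞ with hrtop | hrtop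
  · refine le_trans ?_ (le_mul_of_one_le_left' (by norm_num))
    rw [lorentzNorm, if_pos hrtop, dyadicCoeff, ← ENNReal.ofReal_two_zpow]
    exact le_iSup₂_of_le ((2 : ℝ) ^ m) (by simp; positivity) le_rfl
  · have hr0 : 0 < r.toReal := ENNReal.toReal_pos (by positivity) hrtop
    have h := (ENNReal.le_tsum m).trans (tsum_dyadicCoeff_rpow_le (μ := μ) (f := f) hp hr hrtop)
    rw [ENNReal.rpow_le_rpow_iff hr0] at h
    rw [mul_comm]
    exact (ENNReal.div_le_iff (by norm_num) (by norm_num)).1 h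

/-- The weak-type bound f*(2^m) ≲ 2^(-m/p) tends to 0 as m → ∞, since 1/p > 0. -/
theorem exists_decreasingRearrangement_lt (hp0 : 0 < p⁻¹) (hp : p⁻¹ ≤ 1) (hr : 1 ≤ r)
    (hf : lorentzNorm μ p r f ≠ ∞) {c : ℝ≥0∞} (hc : c ≠ 0) :
    ∃ m : ℤ, decreasingRearrangement μ f (2 ^ (m : ℝ)) < c := by
  have hγ : 0 < (p⁻¹).toReal :=
    ENNReal.toReal_pos hp0.ne' (hp.trans_lt ENNReal.one_lt_top).ne
  by_contra! h
  have hA : 4 * lorentzNorm μ p r f ≠ ∞ := ENNReal.mul_ne_top (by simp) hf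
  have hne : (c / (4 * lorentzNorm μ p r f)) ^ ((p⁻¹).toReal)⁻¹ ≠ 0 := by
    simp [ENNReal.rpow_eq_zero_iff, hc, hA]
  obtain ⟨m, hm⟩ := ENNReal.exists_two_rpow_int_lt hne
  have h1 : (2 ^ (m : ℝ)) ^ (p⁻¹).toReal < c / (4 * lorentzNorm μ p r f) := by
    have h := ENNReal.rpow_lt_rpow hm hγ
    rwa [← ENNReal.rpow_mul (c / _), inv_mul_cancel₀ hγ.ne', ENNReal.rpow_one] at h
  have h2 := (mul_le_mul_right (h (-m)) ((2 ^ (((-m : ℤ)) : ℝ)) ^ (p⁻¹).toReal)).trans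
    (dyadicCoeff_le_lorentzNorm (μ := μ) (f := f) hp hr (-m))
  have h3 : ((2 : ℝ≥0∞) ^ (((-m : ℤ)) : ℝ)) ^ (p⁻¹).toReal =
      ((2 ^ (m : ℝ)) ^ (p⁻¹).toReal)⁻¹ := by
    rw [Int.cast_neg, ENNReal.rpow_neg, ENNReal.inv_rpow]
  have hz : ((2 : ℝ≥0∞) ^ (m : ℝ)) ^ (p⁻¹).toReal ≠ 0 :=
    (ENNReal.rpow_pos (ENNReal.two_rpow_pos _) (ENNReal.two_rpow_ne_top _)).ne'
  have ht : ((2 : ℝ≥0∞) ^ (m : ℝ)) ^ (p⁻¹).toReal ≠ ∞ := h1.ne_top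
  rw [h3, mul_comm, ← div_eq_mul_inv, ENNReal.div_le_iff hz ht] at h2
  have h4 := ENNReal.mul_lt_of_lt_div h1
  rw [mul_comm] at h4
  exact h4.not_ge h2

theorem ae_eq_zero_of_lorentzNorm_eq_zero (hp : p⁻¹ ≤ 1) (hr : 1 ≤ r)
    (hf : lorentzNorm μ p r f = 0) : f =ᵐ[μ] 0 := by
  have hzero : ∀ m : ℤ, decreasingRearrangement μ f (2 ^ (m : ℝ)) = 0 := by
    intro m
    have h := dyadicCoeff_le_lorentzNorm (μ := μ) (f := f) hp hr m
    rw [hf, mul_zero, nonpos_iff_eq_zero, dyadicCoeff, mul_eq_zero] at h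
    exact h.resolve_left
      (ENNReal.rpow_pos (ENNReal.two_rpow_pos _) (ENNReal.two_rpow_ne_top _)).ne'
  rw [Filter.EventuallyEq, ae_iff]
  by_contra hne
  obtain ⟨m, hm⟩ := ENNReal.exists_two_rpow_int_lt hne
  refine hm.not_ge (le_trans (measure_mono fun x hx => ?_)
    (measure_decreasingRearrangement_lt_le μ f (2 ^ (m : ℝ))))
  rw [mem_ofPred_eq, hzero]
  exact pos_iff_ne_zero.2 hx

/-- After normalisation the dyadic coefficients are dominated by powers `F ^ θ`, `θ ≤ 1 / r`, of a
sequence with sum at most one. -/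
theorem exists_tsum_le_one_dyadicCoeff_le (hp : p⁻¹ ≤ 1) (hr : 1 ≤ r)
    (h0 : lorentzNorm μ p r f ≠ 0) (htop : lorentzNorm μ p r f ≠ ∞) :
    ∃ F : ℤ → ℝ≥0∞, ∑' m, F m ≤ 1 ∧ ∀ θ : ℝ, 0 ≤ θ → θ ≤ (r⁻¹).toReal → ∀ m,
      dyadicCoeff μ p f m ≤ 4 * lorentzNorm μ p r f * F m ^ θ := by
  set A := lorentzNorm μ p r f
  rcases eq_or_ne r ∞ with hrtop | hrtop
  -- For r = ∞ only θ = 0 is allowed, and 0 ^ 0 = 1 lets F = 0 serve.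
  · refine ⟨0, by simp, fun θ hθ hθr m => ?_⟩
    obtain rfl : θ = 0 := le_antisymm (by simpa [hrtop] using hθr) hθ
    simpa using dyadicCoeff_le_lorentzNorm hp hr m
  · have hr0 : 0 < r.toReal := ENNReal.toReal_pos (by positivity) hrtop
    have hsum : ∑' m, (dyadicCoeff μ p f m / 4 / A) ^ r.toReal ≤ 1 := by
      simp_rw [ENNReal.div_rpow_of_nonneg _ A hr0.le, div_eq_mul_inv _ (A ^ r.toReal)]
      rw [ENNReal.tsum_mul_right, ← div_eq_mul_inv]
      refine ENNReal.div_le_of_le_mul ?_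
      rw [one_mul]
      exact tsum_dyadicCoeff_rpow_le hp hr hrtop
    -- F^θ is the normalised coefficient to the power rθ ≤ 1, which does not decrease a number that
    -- is at most 1.
    refine ⟨fun m => (dyadicCoeff μ p f m / 4 / A) ^ r.toReal, hsum, fun θ hθ hθr m => ?_⟩
    have hle : (dyadicCoeff μ p f m / 4 / A) ^ r.toReal ≤ 1 := (ENNReal.le_tsum m).trans hsum
    have hle' : dyadicCoeff μ p f m / 4 / A ≤ 1 := by
      simpa using (ENNReal.rpow_le_rpow_iff (y := 1) hr0).1 (by simpa using hle)
    calc dyadicCoeff μ p f m = 4 * A * (dyadicCoeff μ p f m / 4 / A) := by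
          rw [mul_assoc, ENNReal.mul_div_cancel h0 htop,
            ENNReal.mul_div_cancel (by norm_num) (by norm_num)]
      _ ≤ _ := by
          gcongr
          rw [← ENNReal.rpow_mul]
          conv_lhs => rw [← ENNReal.rpow_one (dyadicCoeff μ p f m / 4 / A)]
          refine ENNReal.rpow_le_rpow_of_exponent_ge hle' ?_
          rw [ENNReal.toReal_inv] at hθr
          calc r.toReal * θ ≤ r.toReal * r.toReal⁻¹ := by gcongr
            _ = 1 := mul_inv_cancel₀ hr0.ne'

end Lorentz

/-! ### Summation over multi-indices -/

section Sums

theorem ENNReal.prod_tsum_eq_tsum_prod {ι : Type*} {N : ℕ} (g : Fin N → ι → ℝ≥0∞) :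
    ∏ j, ∑' m, g j m = ∑' m : Fin N → ι, ∏ j, g j (m j) := by
  induction N with
  | zero => simp
  | succ N ih =>
    rw [Fin.prod_univ_succ, ih, ← (Fin.consEquiv fun _ => ι).tsum_eq, ENNReal.tsum_prod',
      ← ENNReal.tsum_mul_right]
    refine tsum_congr fun a => ?_
    rw [← ENNReal.tsum_mul_left]
    refine tsum_congr fun m => ?_
    simp [Fin.prod_univ_succ, Fin.consEquiv]

theorem ENNReal.prod_two_rpow {ι : Type*} (s : Finset ι) (x : ι → ℝ) :
    ∏ i ∈ s, (2 : ℝ≥0∞) ^ x i = 2 ^ ∑ i ∈ s, x i := by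
  classical
  induction s using Finset.induction_on with
  | empty => simp
  | insert i s hi ih =>
    rw [Finset.prod_insert hi, Finset.sum_insert hi, ih,
      ENNReal.rpow_add _ _ two_ne_zero ENNReal.ofNat_ne_top]

theorem ENNReal.tsum_two_rpow_neg_mul_abs_ne_top {δ : ℝ} (hδ : 0 < δ) :
    ∑' d : ℤ, (2 : ℝ≥0∞) ^ (-(δ * |(d : ℝ)|)) ≠ ∞ := by
  have hnat : Summable fun n : ℕ => (2 : ℝ) ^ (-(δ * |((n : ℤ) : ℝ)|)) := by
    have h := summable_geometric_of_lt_one (r := (2 : ℝ) ^ (-δ)) (by positivity)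
      (Real.rpow_lt_one_of_one_lt_of_neg _root_.one_lt_two (by linarith))
    refine h.congr fun n => ?_
    rw [← Real.rpow_natCast, ← Real.rpow_mul zero_le_two]
    simp
  have hsum : Summable fun d : ℤ => (2 : ℝ) ^ (-(δ * |(d : ℝ)|)) :=
    summable_int_iff_summable_nat_and_neg.2 ⟨hnat, by simpa using hnat⟩
  have heq : ∀ d : ℤ, (2 : ℝ≥0∞) ^ (-(δ * |(d : ℝ)|)) =
      ENNReal.ofReal ((2 : ℝ) ^ (-(δ * |(d : ℝ)|))) := fun d => by
    rw [← ENNReal.ofReal_rpow_of_pos two_pos, ENNReal.ofReal_ofNat]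
  simp_rw [heq]
  exact hsum.tsum_ofReal_ne_top

/-- Hölder's inequality for translates of `N` normalised sequences on `ℤ`. -/
theorem tsum_prod_translate_rpow_le_one {N : ℕ} {F : Fin N → ℤ → ℝ≥0∞} {θ : Fin N → ℝ}
    (hF : ∀ j, ∑' m, F j m ≤ 1) (hθ0 : ∀ j, 0 ≤ θ j) (hθ : ∑ j, θ j = 1) (d : Fin N → ℤ) :
    ∑' n : ℤ, ∏ j, F j (n + d j) ^ θ j ≤ 1 := by
  have h := ENNReal.lintegral_prod_norm_pow_le (μ := (Measure.count : Measure ℤ)) Finset.univ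
    (f := fun j n => F j (n + d j)) (fun j _ => (measurable_of_countable _).aemeasurable) hθ
    (fun j _ => hθ0 j)
  simp only [lintegral_count] at h
  refine h.trans (Finset.prod_le_one' fun j _ => ?_)
  have hj : ∑' n, F j (n + d j) ≤ 1 := by
    exact ((Equiv.addRight (d j)).tsum_eq (F j)).trans_le (hF j)
  simpa using ENNReal.rpow_le_rpow hj (hθ0 j)

/-- Reindex by the differences d_j = m_j - m_{j₀} and the base n = m_{j₀}. Forgetting that d_{j₀} =
0 only enlarges the sum, which then factorises over d. -/
theorem tsum_prod_kernel_le {N : ℕ} (j₀ : Fin N) (w : ℤ → ℝ≥0∞) (G : Fin N → ℤ → ℝ≥0∞)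
    (hG : ∀ d : Fin N → ℤ, ∑' n : ℤ, ∏ j, G j (n + d j) ≤ 1) :
    ∑' m : Fin N → ℤ, ∏ j, (w (m j - m j₀) * G j (m j)) ≤ (∑' d, w d) ^ N := by
  let H : (Fin N → ℤ) × ℤ → ℝ≥0∞ := fun q => ∏ j, (w (q.1 j) * G j (q.2 + q.1 j))
  let φ : (Fin N → ℤ) → (Fin N → ℤ) × ℤ := fun m => (fun j => m j - m j₀, m j₀)
  have hφ : Function.Injective φ := by
    intro m m' h
    simp only [φ, Prod.mk.injEq] at h
    funext j
    have h1 := congrFun h.1 j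
    have h2 := h.2
    omega
  calc ∑' m : Fin N → ℤ, ∏ j, (w (m j - m j₀) * G j (m j)) = ∑' m, H (φ m) := by
        simp [H, φ]
    _ ≤ ∑' q, H q := ENNReal.tsum_comp_le_tsum_of_injective hφ H
    _ = ∑' d : Fin N → ℤ, (∏ j, w (d j)) * ∑' n : ℤ, ∏ j, G j (n + d j) := by
        rw [ENNReal.tsum_prod']
        simp [H, Finset.prod_mul_distrib, ENNReal.tsum_mul_left]
    _ ≤ ∑' d : Fin N → ℤ, ∏ j, w (d j) :=
        ENNReal.tsum_le_tsum fun d => mul_le_of_le_one_right' (hG d)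
    _ = (∑' d, w d) ^ N := by
        rw [← ENNReal.prod_tsum_eq_tsum_prod fun _ => w]
        simp

end Sums

/-! ### Off-diagonal gain from the exponents -/

section Exponents

/-- A point of `(0, 1) ^ N` on the hyperplane `∑ a = 2` lies in the interior of the hypersimplex
spanned by the `e i + e j`, so that the smallest of the linear forms `x i + x j` beats
`∑ a l * x l` by a multiple of the spread of `x`. -/
theorem exists_pair_add_le {ι : Type*} [Fintype ι] [Nontrivial ι] {a : ι → ℝ} {ε : ℝ}
    (hε0 : 0 ≤ ε) (hε : ∀ l, ε ≤ a l) (hε' : ∀ l, ε ≤ 1 - a l) (ha : ∑ l, a l = 2) (x : ι → ℝ) :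
    ∃ i j, i ≠ j ∧ ∀ l l', x i + x j - ∑ l, a l * x l ≤ -(ε * |x l - x l'|) := by
  classical
  obtain ⟨i, -, hi⟩ := Finset.exists_min_image Finset.univ x Finset.univ_nonempty
  have hne : (Finset.univ.erase i).Nonempty := by
    obtain ⟨j, hj⟩ := exists_ne i
    exact ⟨j, by simp [hj]⟩
  obtain ⟨j, hj, hjmin⟩ := Finset.exists_min_image (Finset.univ.erase i) x hne
  have hji : j ≠ i := by simpa using hj
  refine ⟨i, j, hji.symm, ?_⟩
  -- With x i ≤ x j the two smallest values, ∑ a = 2 gives ∑ a x - x i - x j = (1 - a i)(x j - x i)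
  -- + ∑_{l ≠ i} a l (x l - x j), all terms nonnegative.
  have hid : ∑ l, a l * (x l - x j) = ∑ l, a l * x l - 2 * x j := by
    simp_rw [mul_sub]
    rw [Finset.sum_sub_distrib, ← Finset.sum_mul, ha]
  have hsplit := Finset.add_sum_erase Finset.univ (fun l => a l * (x l - x j)) (Finset.mem_univ i)
  simp only [hid] at hsplit
  have hij := hi j (Finset.mem_univ _)
  have hgap : ∀ l, x i + x j - ∑ l, a l * x l ≤ -(ε * (x l - x i)) := by
    have hother : ∀ l, l ≠ i → x i + x j - ∑ l, a l * x l ≤ -(ε * (x l - x i)) := by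
      intro l hl
      have hmem : l ∈ Finset.univ.erase i := by simp [hl]
      have h1 : a l * (x l - x j) ≤ ∑ l ∈ Finset.univ.erase i, a l * (x l - x j) :=
        Finset.single_le_sum (f := fun l => a l * (x l - x j))
          (fun q hq => mul_nonneg (hε0.trans (hε q)) (sub_nonneg.2 (hjmin q hq))) hmem
      have h2 := mul_le_mul_of_nonneg_right (hε l) (sub_nonneg.2 (hjmin l hmem))
      have h3 := mul_le_mul_of_nonneg_right (hε' i) (sub_nonneg.2 hij)
      nlinarith
    intro l
    rcases eq_or_ne l i with rfl | hl
    · have := hother j hji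
      have := mul_nonneg hε0 (sub_nonneg.2 hij)
      linarith
    · exact hother l hl
  intro l l'
  rcases abs_cases (x l - x l') with ⟨h, -⟩ | ⟨h, -⟩
  · have := mul_le_mul_of_nonneg_left (hi l' (Finset.mem_univ _)) hε0
    rw [h]
    linarith [hgap l]
  · have := mul_le_mul_of_nonneg_left (hi l (Finset.mem_univ _)) hε0
    rw [h]
    linarith [hgap l']

/-- Averaging the gap over l turns the spread into a sum, so that its exponential is a product over
l. -/
theorem exists_pair_add_le_sum {ι : Type*} [Fintype ι] [Nontrivial ι] {a : ι → ℝ}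
    (ha0 : ∀ l, 0 < a l) (ha1 : ∀ l, a l < 1) (ha : ∑ l, a l = 2) :
    ∃ δ : ℝ, 0 < δ ∧ ∀ x : ι → ℝ, ∀ l₀, ∃ i j, i ≠ j ∧
      x i + x j - ∑ l, a l * x l ≤ ∑ l, -(δ * |x l - x l₀|) := by
  obtain ⟨i₁, -, h₁⟩ := Finset.exists_min_image Finset.univ a Finset.univ_nonempty
  obtain ⟨i₂, -, h₂⟩ := Finset.exists_max_image Finset.univ a Finset.univ_nonempty
  set ε := min (a i₁) (1 - a i₂)
  have hε : 0 < ε := lt_min (ha0 _) (sub_pos.2 (ha1 _))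
  have hcard : (0 : ℝ) < Fintype.card ι := by exact_mod_cast Fintype.card_pos
  refine ⟨ε / Fintype.card ι, by positivity, fun x l₀ => ?_⟩
  obtain ⟨i, j, hij, h⟩ := exists_pair_add_le hε.le
    (fun l => (min_le_left _ _).trans (h₁ l (Finset.mem_univ _)))
    (fun l => (min_le_right _ _).trans (by linarith [h₂ l (Finset.mem_univ _)])) ha x
  refine ⟨i, j, hij, ?_⟩
  calc x i + x j - ∑ l, a l * x l
      = ∑ _l : ι, (x i + x j - ∑ l, a l * x l) / Fintype.card ι := by
        rw [Finset.sum_const, Finset.card_univ, nsmul_eq_mul, mul_div_cancel₀ _ hcard.ne']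
    _ ≤ _ := by
        refine Finset.sum_le_sum fun l _ => ?_
        rw [div_mul_eq_mul_div, ← neg_div]
        exact div_le_div_of_nonneg_right (h l l₀) hcard.le

end Exponents

/-! ### Linear changes of variables -/

section Geometry

variable {k : ℕ}

/-- The linear map `x ↦ (u · x, w · x)` on `ℝᵏ × ℝᵏ`. -/
def vecDotPair (u w : Fin 2 → ℝ) :
    ((Fin k → ℝ) × (Fin k → ℝ)) →ₗ[ℝ] (Fin k → ℝ) × (Fin k → ℝ) where
  toFun x := (vecDot u x, vecDot w x)
  map_add' x y := by
    ext i <;> simp [vecDot] <;> ring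
  map_smul' c x := by
    ext i <;> simp [vecDot] <;> ring

/-- Cramer's rule in each of the k coordinates shows that the kernel is trivial. -/
theorem det_vecDotPair_ne_zero {u w : Fin 2 → ℝ} (h : LinearIndependent ℝ ![u, w]) :
    LinearMap.det (vecDotPair (k := k) u w) ≠ 0 := by
  intro hdet
  obtain ⟨x, hx, hx0⟩ := SetLike.exists_of_lt (LinearMap.bot_lt_ker_of_det_eq_zero hdet)
  have huw : u 0 * w 1 - u 1 * w 0 ≠ 0 := by
    have := (Matrix.linearIndependent_rows_iff_isUnit (A := Matrix.of ![u, w])).1 h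
    rw [Matrix.isUnit_iff_isUnit_det, Matrix.det_fin_two] at this
    simpa using this.ne_zero
  refine hx0 ?_
  have hpair : vecDot u x = 0 ∧ vecDot w x = 0 := by
    simpa [vecDotPair] using hx
  have h1 : ∀ i, u 0 * x.1 i + u 1 * x.2 i = 0 := fun i => by
    simpa [vecDot] using congrFun hpair.1 i
  have h2 : ∀ i, w 0 * x.1 i + w 1 * x.2 i = 0 := fun i => by
    simpa [vecDot] using congrFun hpair.2 i
  rw [Submodule.mem_bot]
  ext i
  · refine (mul_eq_zero.1 (?_ : (u 0 * w 1 - u 1 * w 0) * x.1 i = 0)).resolve_left huw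
    linear_combination w 1 * h1 i - u 1 * h2 i
  · refine (mul_eq_zero.1 (?_ : (u 0 * w 1 - u 1 * w 0) * x.2 i = 0)).resolve_left huw
    linear_combination u 0 * h2 i - w 0 * h1 i

theorem measurable_vecDot (u : Fin 2 → ℝ) : Measurable (vecDot (k := k) u) := by
  unfold vecDot
  fun_prop

theorem map_vecDotPair {u w : Fin 2 → ℝ} (h : LinearIndependent ℝ ![u, w]) :
    Measure.map (fun x : (Fin k → ℝ) × (Fin k → ℝ) => (vecDot u x, vecDot w x)) volume =
      ENNReal.ofReal |(LinearMap.det (vecDotPair (k := k) u w))⁻¹| • volume := by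
  have : (volume : Measure ((Fin k → ℝ) × (Fin k → ℝ))).IsAddHaarMeasure := by
    rw [Measure.volume_eq_prod]
    exact Measure.prod.instIsAddHaarMeasure _ _
  exact Measure.map_linearMap_addHaar_eq_smul_addHaar volume (det_vecDotPair_ne_zero h)

/-- A null set pulls back to a null set: the map is an invertible linear map followed by a
projection. -/
theorem quasiMeasurePreserving_vecDot {u w : Fin 2 → ℝ} (h : LinearIndependent ℝ ![u, w]) :
    Measure.QuasiMeasurePreserving (vecDot (k := k) u) volume volume := by
  have hpair : Measure.QuasiMeasurePreserving
      (fun x : (Fin k → ℝ) × (Fin k → ℝ) => (vecDot u x, vecDot w x)) volume volume :=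
    ⟨(measurable_vecDot u).prodMk (measurable_vecDot w), by
      rw [map_vecDotPair h]
      exact Measure.smul_absolutelyContinuous⟩
  exact Measure.quasiMeasurePreserving_fst.comp hpair

theorem exists_lintegral_indicator_vecDot_le {N : ℕ} {v : Fin N → Fin 2 → ℝ}
    (hv : ∀ i j, i ≠ j → LinearIndependent ℝ ![v i, v j]) :
    ∃ D : ℝ≥0, ∀ E : Fin N → Set (Fin k → ℝ), (∀ j, MeasurableSet (E j)) → ∀ i j, i ≠ j →
      brascampLiebForm v (fun l => (E l).indicator 1) ≤ D * (volume (E i) * volume (E j)) := by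
  classical
  let c : Fin N → Fin N → ℝ≥0 := fun i j =>
    |(LinearMap.det (vecDotPair (k := k) (v i) (v j)))⁻¹|.toNNReal
  refine ⟨∑ i, ∑ j, c i j, fun E hE i j hij => ?_⟩
  have hc : c i j ≤ ∑ i, ∑ j, c i j :=
    (Finset.single_le_sum (f := fun j => c i j) (fun _ _ => zero_le) (Finset.mem_univ j)).trans
      (Finset.single_le_sum (f := fun i => ∑ j, c i j) (fun _ _ => zero_le) (Finset.mem_univ i))
  calc brascampLiebForm v (fun l => (E l).indicator 1)
      ≤ ∫⁻ x, ((fun x => (vecDot (v i) x, vecDot (v j) x)) ⁻¹' (E i ×ˢ E j)).indicator 1 x := by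
        refine lintegral_mono fun x => ?_
        by_cases hx : vecDot (v i) x ∈ E i ∧ vecDot (v j) x ∈ E j
        · rw [indicator_of_mem (by exact hx)]
          exact Finset.prod_le_one' fun l _ => indicator_le_self' (by simp) _
        · have : ∏ l, (E l).indicator (1 : (Fin k → ℝ) → ℝ≥0∞) (vecDot (v l) x) = 0 := by
            rw [Finset.prod_eq_zero_iff]
            rcases not_and_or.1 hx with h | h
            · exact ⟨i, Finset.mem_univ _, by simp [h]⟩
            · exact ⟨j, Finset.mem_univ _, by simp [h]⟩
          simp [this]
    _ = Measure.map (fun x : (Fin k → ℝ) × (Fin k → ℝ) => (vecDot (v i) x, vecDot (v j) x)) volume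
          (E i ×ˢ E j) := by
        have hm : Measurable fun x : (Fin k → ℝ) × (Fin k → ℝ) =>
          (vecDot (v i) x, vecDot (v j) x) := (measurable_vecDot _).prodMk (measurable_vecDot _)
        rw [lintegral_indicator_one (hm ((hE i).prod (hE j))),
          Measure.map_apply hm ((hE i).prod (hE j))]
    _ = c i j * (volume (E i) * volume (E j)) := by
        rw [map_vecDotPair (hv i j hij), Measure.smul_apply, Measure.volume_eq_prod,
          Measure.prod_prod]
        rfl
    _ ≤ _ := by gcongr

end Geometry

/-! ### Assembling the estimate -/

section Main

variable {N k : ℕ} {v : Fin N → Fin 2 → ℝ} {f g : Fin N → (Fin k → ℝ) → ℝ≥0∞}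

theorem brascampLiebForm_mono_ae [Nontrivial (Fin N)]
    (hv : ∀ i j, i ≠ j → LinearIndependent ℝ ![v i, v j]) (hfg : ∀ j, f j ≤ᵐ[volume] g j) :
    brascampLiebForm v f ≤ brascampLiebForm v g := by
  have h : ∀ j, ∀ᵐ x : (Fin k → ℝ) × (Fin k → ℝ), f j (vecDot (v j) x) ≤ g j (vecDot (v j) x) := by
    intro j
    obtain ⟨i, hi⟩ := exists_ne j
    exact (quasiMeasurePreserving_vecDot (hv j i hi.symm)).ae (hfg j)
  refine lintegral_mono_ae ?_
  filter_upwards [ae_all_iff.2 h] with x hx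
  exact Finset.prod_le_prod' fun j _ => hx j

theorem brascampLiebForm_tsum (b : Fin N → ℤ → ℝ≥0∞) {E : Fin N → ℤ → Set (Fin k → ℝ)}
    (hE : ∀ j m, MeasurableSet (E j m)) :
    brascampLiebForm v (fun j y => ∑' m, b j m * (E j m).indicator 1 y) =
      ∑' m : Fin N → ℤ, (∏ j, b j (m j)) *
        brascampLiebForm v (fun j => (E j (m j)).indicator 1) := by
  have hmeas : ∀ m : Fin N → ℤ, Measurable fun x : (Fin k → ℝ) × (Fin k → ℝ) =>
      ∏ j, (E j (m j)).indicator (1 : (Fin k → ℝ) → ℝ≥0∞) (vecDot (v j) x) := fun m =>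
    Finset.measurable_prod _ fun j _ =>
      (measurable_one.indicator (hE j (m j))).comp (measurable_vecDot (v j))
  unfold brascampLiebForm
  simp_rw [ENNReal.prod_tsum_eq_tsum_prod, Finset.prod_mul_distrib]
  rw [lintegral_tsum fun m => ((hmeas m).const_mul _).aemeasurable]
  exact tsum_congr fun m => lintegral_const_mul _ (hmeas m)

theorem dyadicCoeff_eq (p : ℝ≥0∞) (h : (Fin k → ℝ) → ℝ≥0∞) (m : ℤ) :
    decreasingRearrangement volume h (2 ^ (m : ℝ)) =
      2 ^ (-((p⁻¹).toReal * m)) * dyadicCoeff volume p h m := by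
  rw [dyadicCoeff, ← ENNReal.rpow_mul, ← mul_assoc,
    ← ENNReal.rpow_add _ _ two_ne_zero ENNReal.ofNat_ne_top, mul_comm (m : ℝ), neg_add_cancel,
    ENNReal.rpow_zero, one_mul]

/-- The estimate with normalised exponents `θ j ≤ 1 / r j`, `∑ θ = 1`, for functions whose Lorentz
norms are positive and finite. -/
theorem exists_brascampLiebForm_le_of_norm_ne [Nontrivial (Fin N)]
    (hv : ∀ i j, i ≠ j → LinearIndependent ℝ ![v i, v j]) {p r : Fin N → ℝ≥0∞}
    (hp : ∀ j, (p j)⁻¹ ∈ Ioo (0 : ℝ≥0∞) 1) (hscal : ∑ j, (p j)⁻¹ = 2) (hr : ∀ j, 1 ≤ r j)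
    {θ : Fin N → ℝ} (hθ0 : ∀ j, 0 ≤ θ j) (hθr : ∀ j, θ j ≤ ((r j)⁻¹).toReal)
    (hθ : ∑ j, θ j = 1) :
    ∃ C : ℝ≥0, ∀ f : Fin N → (Fin k → ℝ) → ℝ≥0∞,
      (∀ j, lorentzNorm volume (p j) (r j) (f j) ≠ 0) →
      (∀ j, lorentzNorm volume (p j) (r j) (f j) ≠ ∞) →
        brascampLiebForm v f ≤ C * ∏ j, lorentzNorm volume (p j) (r j) (f j) := by
  have hptop : ∀ j, (p j)⁻¹ ≠ ∞ := fun j => ((hp j).2.trans ENNReal.one_lt_top).ne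
  have hsum : ∑ j, ((p j)⁻¹).toReal = 2 := by
    rw [← ENNReal.toReal_sum fun j _ => hptop j, hscal, ENNReal.toReal_ofNat]
  obtain ⟨δ, hδ, hgap⟩ := exists_pair_add_le_sum
    (fun j => ENNReal.toReal_pos (hp j).1.ne' (hptop j))
    (fun j => by simpa using (ENNReal.toReal_lt_toReal (hptop j) ENNReal.one_ne_top).2 (hp j).2)
    hsum
  obtain ⟨D, hD⟩ := exists_lintegral_indicator_vecDot_le (k := k) hv
  obtain ⟨j₀, -⟩ := exists_pair_ne (Fin N)
  let w : ℤ → ℝ≥0∞ := fun d => 2 ^ (-(δ * |(d : ℝ)|))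
  have hw : ∑' d, w d ≠ ∞ := ENNReal.tsum_two_rpow_neg_mul_abs_ne_top hδ
  -- D is the geometric constant, 4 comes from two measures 2^(m+1), 4^N from the N coefficient
  -- bounds, the last factor from the kernel.
  let K : ℝ≥0∞ := D * 4 * 4 ^ N * (∑' d, w d) ^ N
  have hK : K ≠ ∞ := by
    refine ENNReal.mul_ne_top (ENNReal.mul_ne_top (ENNReal.mul_ne_top ENNReal.coe_ne_top ?_) ?_) ?_
    · exact ENNReal.ofNat_ne_top
    · exact ENNReal.pow_ne_top ENNReal.ofNat_ne_top
    · exact ENNReal.pow_ne_top hw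
  refine ⟨K.toNNReal, fun f hf0 hftop => ?_⟩
  rw [ENNReal.coe_toNNReal hK]
  choose F hF hFle using fun j =>
    exists_tsum_le_one_dyadicCoeff_le (hp j).2.le (hr j) (hf0 j) (hftop j)
  choose E hE hEμ hfE using fun j => exists_dyadic_majorant (μ := volume) (f := f j)
    fun _ hc => exists_decreasingRearrangement_lt (hp j).1 (hp j).2.le (hr j) (hftop j) hc
  set A : Fin N → ℝ≥0∞ := fun j => lorentzNorm volume (p j) (r j) (f j)
  have hterm : ∀ m : Fin N → ℤ,
      (∏ j, decreasingRearrangement volume (f j) (2 ^ (m j : ℝ))) *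
        brascampLiebForm v (fun j => (E j (m j)).indicator 1) ≤
      D * 4 * 4 ^ N * (∏ j, A j) * ∏ j, (w (m j - m j₀) * F j (m j) ^ θ j) := by
    intro m
    obtain ⟨i, j, hij, hle⟩ := hgap (fun l => (m l : ℝ)) j₀
    have hprod : ∏ l, decreasingRearrangement volume (f l) (2 ^ (m l : ℝ)) ≤
        2 ^ (-∑ l, ((p l)⁻¹).toReal * m l) *
          (4 ^ N * (∏ l, A l) * ∏ l, F l (m l) ^ θ l) := by
      calc _ ≤ ∏ l, (2 : ℝ≥0∞) ^ (-(((p l)⁻¹).toReal * m l)) * (4 * A l * F l (m l) ^ θ l) := by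
            refine Finset.prod_le_prod' fun l _ => ?_
            rw [dyadicCoeff_eq (p l)]
            gcongr
            exact hFle l (θ l) (hθ0 l) (hθr l) (m l)
        _ = _ := by
            rw [Finset.prod_mul_distrib, ENNReal.prod_two_rpow, Finset.sum_neg_distrib]
            simp [Finset.prod_mul_distrib]
    have hform : brascampLiebForm v (fun l => (E l (m l)).indicator 1) ≤
        D * (4 * 2 ^ ((m i : ℝ) + m j)) := by
      refine (hD (fun l => E l (m l)) (fun l => hE l (m l)) i j hij).trans
        (mul_le_mul_right ?_ _)
      calc _ ≤ (2 : ℝ≥0∞) ^ ((m i : ℝ) + 1) * 2 ^ ((m j : ℝ) + 1) :=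
            mul_le_mul' (hEμ i (m i)) (hEμ j (m j))
        _ = _ := by
            simp only [ENNReal.rpow_add _ _ two_ne_zero ENNReal.ofNat_ne_top, ENNReal.rpow_one]
            ring
    have hker : (2 : ℝ≥0∞) ^ (-∑ l, ((p l)⁻¹).toReal * m l) * 2 ^ ((m i : ℝ) + m j) ≤
        ∏ l, w (m l - m j₀) := by
      simp only [w]
      rw [← ENNReal.rpow_add _ _ two_ne_zero ENNReal.ofNat_ne_top, ENNReal.prod_two_rpow]
      refine ENNReal.rpow_le_rpow_of_exponent_le one_le_two ?_
      simp only [Int.cast_sub]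
      linarith
    calc _ ≤ 2 ^ (-∑ l, ((p l)⁻¹).toReal * m l) *
          (4 ^ N * (∏ l, A l) * ∏ l, F l (m l) ^ θ l) * (D * (4 * 2 ^ ((m i : ℝ) + m j))) :=
          mul_le_mul' hprod hform
      _ = D * 4 * 4 ^ N * (∏ l, A l) * ((2 ^ (-∑ l, ((p l)⁻¹).toReal * m l) *
          2 ^ ((m i : ℝ) + m j)) * ∏ l, F l (m l) ^ θ l) := by ring
      _ ≤ _ := by
          rw [Finset.prod_mul_distrib]
          gcongr
  calc brascampLiebForm v f
      ≤ brascampLiebForm v (fun j y => ∑' m : ℤ,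
          decreasingRearrangement volume (f j) (2 ^ (m : ℝ)) * (E j m).indicator 1 y) :=
        brascampLiebForm_mono_ae hv hfE
    _ = ∑' m : Fin N → ℤ, (∏ j, decreasingRearrangement volume (f j) (2 ^ (m j : ℝ))) *
          brascampLiebForm v (fun j => (E j (m j)).indicator 1) :=
        brascampLiebForm_tsum _ hE
    _ ≤ ∑' m : Fin N → ℤ, D * 4 * 4 ^ N * (∏ j, A j) *
          ∏ j, (w (m j - m j₀) * F j (m j) ^ θ j) := ENNReal.tsum_le_tsum hterm
    _ ≤ D * 4 * 4 ^ N * (∏ j, A j) * (∑' d, w d) ^ N := by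
        rw [ENNReal.tsum_mul_left]
        gcongr
        exact tsum_prod_kernel_le j₀ w (fun j n => F j n ^ θ j)
          fun d => tsum_prod_translate_rpow_le_one hF hθ0 hθ d
    _ = K * ∏ j, A j := by ring

/-- Dividing 1/r_j by their sum, which is at least 1, only lowers them. -/
theorem exists_normalised_exponents {ι : Type*} [Fintype ι] {r : ι → ℝ≥0∞}
    (hr : ∀ j, 1 ≤ r j) (hrsum : 1 ≤ ∑ j, (r j)⁻¹) :
    ∃ θ : ι → ℝ, (∀ j, 0 ≤ θ j) ∧ (∀ j, θ j ≤ ((r j)⁻¹).toReal) ∧ ∑ j, θ j = 1 := by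
  have htop : ∀ j, (r j)⁻¹ ≠ ∞ := fun j =>
    ((ENNReal.inv_le_one.2 (hr j)).trans_lt ENNReal.one_lt_top).ne
  have hS : 1 ≤ ∑ j, ((r j)⁻¹).toReal := by
    rw [← ENNReal.toReal_sum fun j _ => htop j, ← ENNReal.toReal_one]
    exact ENNReal.toReal_mono (ENNReal.sum_ne_top.2 fun j _ => htop j) hrsum
  refine ⟨fun j => ((r j)⁻¹).toReal / ∑ j, ((r j)⁻¹).toReal, fun j => by positivity,
    fun j => div_le_self ENNReal.toReal_nonneg hS, ?_⟩
  rw [← Finset.sum_div, div_self (by positivity)]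

end Main

theorem theorem2p2 {N k : ℕ} (hk : 1 ≤ k) (v : Fin N → Fin 2 → ℝ)
    (hv0 : ∀ j, v j ≠ 0)
    (hv : ∀ i j, i ≠ j →
      LinearIndependent ℝ ![v i, v j] ∧ Submodule.span ℝ {v i, v j} = ⊤)
    (p r : Fin N → ℝ≥0∞)
    (hp : ∀ j, (p j)⁻¹ ∈ Set.Ioo (0 : ℝ≥0∞) 1)
    (hscal : ∑ j, (p j)⁻¹ = 2)
    (hr : ∀ j, 1 ≤ r j)
    (hrsum : 1 ≤ ∑ j, (r j)⁻¹) :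
    ∃ C : ℝ≥0, ∀ f : Fin N → (Fin k → ℝ) → ℝ≥0∞,
      (∀ j, AEMeasurable (f j) volume) →
        brascampLiebForm v f ≤ C * ∏ j, lorentzNorm volume (p j) (r j) (f j) := by
  -- Numbers 1/p_j < 1 need at least two terms to sum to 2.
  have hnt : Nontrivial (Fin N) := by
    rw [← not_subsingleton_iff_nontrivial]
    intro hsub
    rcases isEmpty_or_nonempty (Fin N) with hemp | ⟨⟨j⟩⟩
    · simp at hscal
    · rw [Fintype.sum_subsingleton _ j] at hscal
      exact absurd (hp j).2 (by rw [hscal]; exact not_lt.2 one_le_two)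
  have hli : ∀ i j, i ≠ j → LinearIndependent ℝ ![v i, v j] := fun i j hij => (hv i j hij).1
  obtain ⟨θ, hθ0, hθr, hθ⟩ := exists_normalised_exponents hr hrsum
  obtain ⟨C, hC⟩ := exists_brascampLiebForm_le_of_norm_ne (k := k) hli hp hscal hr hθ0 hθr hθ
  -- The constant must be nonzero so that its product with ∞ is ∞ when some norm is infinite.
  refine ⟨C + 1, fun f _ => ?_⟩
  by_cases h0 : ∃ j, lorentzNorm volume (p j) (r j) (f j) = 0
  · obtain ⟨j, hj⟩ := h0
    have hz := ae_eq_zero_of_lorentzNorm_eq_zero (hp j).2.le (hr j) hj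
    refine (brascampLiebForm_mono_ae (g := fun l => if l = j then 0 else f l) hli
      fun l => ?_).trans (le_of_eq_of_le ?_ zero_le)
    · by_cases hl : l = j
      · subst hl
        simpa using hz.le
      · simpa [hl] using Filter.EventuallyLE.refl _ _
    · refine lintegral_eq_zero_of_ae_eq_zero (Filter.Eventually.of_forall fun x => ?_)
      exact Finset.prod_eq_zero (Finset.mem_univ j) (by simp)
  push Not at h0
  by_cases htop : ∃ j, lorentzNorm volume (p j) (r j) (f j) = ∞
  · obtain ⟨j, hj⟩ := htop
    have hprod : ∏ j, lorentzNorm volume (p j) (r j) (f j) = ∞ := by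
      rw [← Finset.mul_prod_erase _ _ (Finset.mem_univ j), hj,
        ENNReal.top_mul (Finset.prod_ne_zero_iff.2 fun l _ => h0 l)]
    rw [hprod, ENNReal.mul_top (by simp)]
    exact le_top
  push Not at htop
  refine (hC f h0 htop).trans ?_
  gcongr
  exact le_self_add
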